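/- **Theorem (atomizing embedding).** Consider System F ($\mathsf{\Lambda 2}$) in Church style, with types $A,B ::= X \mid A\Rightarrow B\mid \forall X.A$ and terms $t,u ::= x\mid \lambda x^{A}.t\mid tu\mid \Lambda X.t\mid tB$. *The systems.* A polynomial type is here a type $P[X]=\langle\langle A_{jk}\rangle_{j}\Rightarrow X\rangle_{k}\Rightarrow X$ (finite, possibly empty, lists of indices $j,k$; $\langle C_i\rangle_{i}\Rightarrow D$ abbreviates $C_{1}\Rightarrow\dots\Rightarrow C_{n}\Rightarrow D$) such that $X$ does not occur free in any $A_{jk}$. $\mathsf{\Lambda 2^{Poly}}$ is the fragment of $\mathsf{\Lambda 2}$ whose types are those in which every universal type that occurs is of the form $\forall X.P[X]$ with $P[X]$ polynomial; it has the typing rules of $\mathsf{\Lambda 2}$, all types in a derivation being types of the fragment. $\mathsf{\Lambda 2_{at}}$ is the subsystem of $\mathsf{\Lambda 2}$ with all the types of $\mathsf{\Lambda 2}$ in which a term $t:\forall X.A$ may be instantiated only at type variables. *The $\varepsilon$-theory.* For a type $A$ in which all occurrences of $X$ are positive (or all are negative) and a term $v[x]$ with distinguished variable $x$, let $\Phi_X(v)=v$,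 $\Phi_Y(v)=x$ for $Y\neq X$, $\Phi_{C\Rightarrow D}(v)=\lambda y.\Phi_D(v)[x\mapsto x\,(\Phi_C(v)[x\mapsto y])]$, $\Phi_{\forall Y.C}(v)=\Lambda Y.\Phi_C(v)[x\mapsto xY]$. The $\varepsilon$-theory $\simeq_\varepsilon$ is the smallest congruence on well-typed terms (equations $\Gamma\vdash t\simeq u:A$) that contains the $\beta$- and $\eta$-equations for $\Rightarrow$ and $\forall$ and is closed under the following two rules. Let $v$ satisfy $\Gamma,x:E\vdash v:F$. (a) Let $\Gamma\vdash t:\forall X.\langle\forall\vec Y_k.\langle A_{jk}\rangle_j\Rightarrow X\rangle_k\Rightarrow B$ with all occurrences of $X$ in $A_{jk}$ and in $B$ positive, $\Gamma\vdash e_k:\forall\vec Y_k.\langle A_{jk}[E/X]\rangle_j\Rightarrow E$ and $\Gamma\vdash f_k:\forall\vec Y_k.\langle A_{jk}[F/X]\rangle_j\Rightarrow F$. If for every $k$, in the context $\Gamma,\langle z_j:A_{jk}[E/X]\rangle_j$, $v[e_k\vec Y_k\langle z_j\rangle_j]\simeq f_k\vec Y_k\langle\Phi_{A_{jk}}(v)[z_j]\rangle_j: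 F$, then $\Gamma\vdash\Phi_B(v)[tE\langle e_k\rangle_k]\simeq tF\langle f_k\rangle_k:B[F/X]$. (b) Let $\Gamma\vdash t:\forall X.\langle\forall\vec Y_j.X\Rightarrow A_j\rangle_j\Rightarrow B$ with all occurrences of $X$ in $A_j$ positive and all those in $B$ negative, $\Gamma\vdash e_j:\forall\vec Y_j.E\Rightarrow A_j[E/X]$ and $\Gamma\vdash f_j:\forall\vec Y_j.F\Rightarrow A_j[F/X]$. If for every $j$, $\Gamma,x:E\vdash\Phi_{A_j}(v)[e_j\vec Y_jx]\simeq f_j\vec Y_j\,v[x]:A_j[F/X]$, then $\Gamma\vdash\Phi_B(v)[tF\langle f_j\rangle_j]\simeq tE\langle e_j\rangle_j:B[E/X]$. *Statement.* If $\Gamma\vdash_{\mathsf{\Lambda 2^{Poly}}}t:A$, then there is a term $t^{\downarrow}$ such that $\Gamma\vdash_{\mathsf{\Lambda 2_{at}}}t^{\downarrow}:A$ and $\Gamma\vdash t\simeq_{\varepsilon}t^{\downarrow}:A$. The equation holds already in the $\varepsilon$-theory of $\mathsf{\Lambda 2^{Poly}}$, that is, in the theory generated as above with all types taken from this fragment,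 and hence in that of every larger fragment of $\mathsf{\Lambda 2}$. -/

import Mathlib

/-! System F in the style of Church, with de Bruijn indices both for type variables and for term
variables: the term `t` below `lam A t` (resp. `tlam t`) has one more term (resp. type) variable,
of index `0`. -/

namespace SystemF

/-- Types: variables, `A ⇒ B`, `∀X.A`. -/
inductive Ty : Type
  | var : ℕ → Ty
  | arrow : Ty → Ty → Ty
  | all : Ty → Ty

/-- Terms: variables, `λ(x : A).t`, `t u`, `ΛX.t`, `t B`. -/
inductive Tm : Type
  | var : ℕ → Tm
  | lam : Ty → Tm → Tm
  | app : Tm → Tm → Tm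
  | tlam : Tm → Tm
  | tapp : Tm → Ty → Tm

/-- A renaming, pushed under one binder. -/
def upr (ξ : ℕ → ℕ) : ℕ → ℕ
  | 0 => 0
  | n + 1 => ξ n + 1

/-! ### Renaming and substitution of types -/

def Ty.ren : (ℕ → ℕ) → Ty → Ty
  | ξ, .var i => .var (ξ i)
  | ξ, .arrow A B => .arrow (A.ren ξ) (B.ren ξ)
  | ξ, .all A => .all (A.ren (upr ξ))

/-- `A`, seen as a type with one more type variable, which does not occur in it. -/
def Ty.lift (A : Ty) : Ty := A.ren Nat.succ

/-- A type substitution, pushed under one type binder. -/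
def Ty.up (σ : ℕ → Ty) : ℕ → Ty
  | 0 => .var 0
  | n + 1 => (σ n).lift

def Ty.subst : (ℕ → Ty) → Ty → Ty
  | σ, .var i => σ i
  | σ, .arrow A B => .arrow (A.subst σ) (B.subst σ)
  | σ, .all A => .all (A.subst (Ty.up σ))

/-- The substitution of `B` for the type variable `0`. -/
def Ty.one (B : Ty) : ℕ → Ty
  | 0 => B
  | n + 1 => .var n

/-- `A[B/X]`, for `X` the type variable `0`. -/
def Ty.inst (A B : Ty) : Ty := A.subst (Ty.one B)

/-- The substitution of `B` for the type variable `n`, below `n` type binders. -/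
def Ty.oneAt (n : ℕ) (B : Ty) : ℕ → Ty := Ty.up^[n] (Ty.one B)

/-! ### Renaming and substitution of terms -/

/-- Renaming of type variables in a term. -/
def Tm.tren : (ℕ → ℕ) → Tm → Tm
  | _, .var i => .var i
  | ξ, .lam A t => .lam (A.ren ξ) (t.tren ξ)
  | ξ, .app t u => .app (t.tren ξ) (u.tren ξ)
  | ξ, .tlam t => .tlam (t.tren (upr ξ))
  | ξ, .tapp t B => .tapp (t.tren ξ) (B.ren ξ)

/-- Renaming of term variables in a term. -/
def Tm.ren : (ℕ → ℕ) → Tm → Tm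
  | ξ, .var i => .var (ξ i)
  | ξ, .lam A t => .lam A (t.ren (upr ξ))
  | ξ, .app t u => .app (t.ren ξ) (u.ren ξ)
  | ξ, .tlam t => .tlam (t.ren ξ)
  | ξ, .tapp t B => .tapp (t.ren ξ) B

/-- Substitution of types for type variables in a term. -/
def Tm.tsubst : (ℕ → Ty) → Tm → Tm
  | _, .var i => .var i
  | σ, .lam A t => .lam (A.subst σ) (t.tsubst σ)
  | σ, .app t u => .app (t.tsubst σ) (u.tsubst σ)
  | σ, .tlam t => .tlam (t.tsubst (Ty.up σ))
  | σ, .tapp t B => .tapp (t.tsubst σ) (B.subst σ)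

/-- A term substitution, pushed under one term binder. -/
def Tm.up (τ : ℕ → Tm) : ℕ → Tm
  | 0 => .var 0
  | n + 1 => (τ n).ren Nat.succ

/-- Substitution of terms for term variables in a term. -/
def Tm.subst : (ℕ → Tm) → Tm → Tm
  | τ, .var i => τ i
  | τ, .lam A t => .lam A (t.subst (Tm.up τ))
  | τ, .app t u => .app (t.subst τ) (u.subst τ)
  | τ, .tlam t => .tlam (t.subst fun i => (τ i).tren Nat.succ)
  | τ, .tapp t B => .tapp (t.subst τ) B

/-- The substitution of `u` for the term variable `0`. -/
def Tm.one (u : Tm) : ℕ → Tm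
  | 0 => u
  | n + 1 => .var n

/-- `t[u/x]`, for `x` the term variable `0`. -/
def Tm.inst (t u : Tm) : Tm := t.subst (Tm.one u)

/-- `t[B/X]`, for `X` the type variable `0`. -/
def Tm.tinst (t : Tm) (B : Ty) : Tm := t.tsubst (Ty.one B)

/-! ### Lists of arguments -/

/-- `⟨A₁, …, Aₖ⟩ ⇒ B`. -/
def arrows (As : List Ty) (B : Ty) : Ty := As.foldr Ty.arrow B

/-- `∀Y₁ … Yₙ. A`. -/
def alls (n : ℕ) (A : Ty) : Ty := Ty.all^[n] A

/-- `t u₁ … uₖ`. -/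
def apps (t : Tm) (us : List Tm) : Tm := us.foldl Tm.app t

/-- The last `n` type variables introduced, in the order of their introduction. -/
def tyVars (n : ℕ) : List Ty := (List.range n).reverse.map Ty.var

/-- The last `m` term variables introduced, in the order of their introduction. -/
def tmVars (m : ℕ) : List Tm := (List.range m).reverse.map Tm.var

/-- `t Y₁ … Yₙ`, for the last `n` type variables introduced. -/
def tappVars (t : Tm) (n : ℕ) : Tm := (tyVars n).foldl Tm.tapp t

/-! ### Typing -/

/-- The judgement `Γ ⊢ t : A` in the subsystem of System F in which all types that occur in
contexts, terms and typing derivations belong to `S`, and all type instantiations `t B` have in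
addition `I B`. The head of the list `Γ` is the type of the term variable `0`. -/
inductive HasType (S I : Ty → Prop) : List Ty → Tm → Ty → Prop
  | var {Γ : List Ty} {i : ℕ} {A : Ty} :
      (∀ B ∈ Γ, S B) → Γ[i]? = some A → HasType S I Γ (.var i) A
  | lam {Γ : List Ty} {A B : Ty} {t : Tm} :
      S (.arrow A B) → HasType S I (A :: Γ) t B → HasType S I Γ (.lam A t) (.arrow A B)
  | app {Γ : List Ty} {A B : Ty} {t u : Tm} :
      S B → HasType S I Γ t (.arrow A B) → HasType S I Γ u A → HasType S I Γ (.app t u) B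
  | tlam {Γ : List Ty} {A : Ty} {t : Tm} :
      S (.all A) → HasType S I (Γ.map Ty.lift) t A → HasType S I Γ (.tlam t) (.all A)
  | tapp {Γ : List Ty} {A B : Ty} {t : Tm} :
      S B → I B → S (A.inst B) → HasType S I Γ t (.all A) →
      HasType S I Γ (.tapp t B) (A.inst B)

/-! ### The functorial action of a type -/

/-- `Occ true i A` (resp. `Occ false i A`): all occurrences of the type variable `i` in `A` are
positive (resp. negative). -/
def Ty.Occ : Bool → ℕ → Ty → Prop
  | pos, i, .var j => j = i → pos = true
  | pos, i, .arrow A B => A.Occ (!pos) i ∧ B.Occ pos i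
  | pos, i, .all A => A.Occ pos (i + 1)

/-- Let `v` be a term with a distinguished variable `x`, the term variable `0`. For `X` the type
variable `i`, `act A i P Q v s` is the term `Φ_A(v)[x ↦ s]`, where
`Φ_X(v) = v`, `Φ_Y(v) = x`, `Φ_{C ⇒ D}(v) = λy. Φ_D(v)[x ↦ x (Φ_C(v)[x ↦ y])]` and
`Φ_{∀Y.C}(v) = ΛY. Φ_C(v)[x ↦ x Y]`. It maps `A.subst P` to `A.subst Q`, where, for
`v[x] : E ⊢ F`, the substitutions `P` and `Q` are `X ↦ E` and `X ↦ F` if `X` is only positive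
in `A`, and `X ↦ F` and `X ↦ E` if `X` is only negative in `A`; they only serve to annotate the
abstractions. -/
def act : Ty → ℕ → (ℕ → Ty) → (ℕ → Ty) → Tm → Tm → Tm
  | .var j, i, _, _, v, s => if j = i then v.inst s else s
  | .arrow C D, i, P, Q, v, s =>
      .lam (C.subst Q)
        (act D i P Q (v.ren (upr Nat.succ))
          (.app (s.ren Nat.succ) (act C i Q P (v.ren (upr Nat.succ)) (.var 0))))
  | .all C, i, P, Q, v, s =>
      .tlam (act C (i + 1) (Ty.up P) (Ty.up Q) (v.tren Nat.succ)
        (.tapp (s.tren Nat.succ) (.var 0)))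

/-! ### The epsilon-theory -/

/-- An argument type `∀Y₁ … Yₙ. ⟨A₁, …, Aₘ⟩ ⇒ X`, with a term `src` of this type for `X = E` and a
term `tgt` of this type for `X = F`. The types `Aⱼ` live below the binders of `X, Y₁, …, Yₙ`, so
that `X` is their variable `n`. -/
structure AlgArg where
  n : ℕ
  dom : List Ty
  src : Tm
  tgt : Tm

/-- An argument type `∀Y₁ … Yₙ. X ⇒ A`, with terms of this type for `X = E` and `X = F`. -/
structure CoalgArg where
  n : ℕ
  cod : Ty
  src : Tm
  tgt : Tm

def AlgArg.ty (d : AlgArg) : Ty := alls d.n (arrows d.dom (.var d.n))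

def CoalgArg.ty (d : CoalgArg) : Ty := alls d.n (.arrow (.var d.n) d.cod)

/-- `weaken n m t`: the term `t` in the context extended by `n` type variables and `m` term
variables. -/
def weaken (n m : ℕ) (t : Tm) : Tm := (t.tren (· + n)).ren (· + m)

/-- The same for a term `v[x]`, whose distinguished variable `x` remains the variable `0`. -/
def weakenBody (n m : ℕ) (v : Tm) : Tm := (v.tren (· + n)).ren (upr (· + m))

/-- The equations `Γ ⊢ t ≃ u : A` of the epsilon-theory of the fragment of System F with types in
`S`: the smallest congruence on well-typed terms that contains the `β`- and `η`-equations and is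
closed under the two `ε`-rules, which express strong dinaturality for the universal types
`∀X. ⟨∀Y⃗ₖ. ⟨Aⱼₖ⟩ⱼ ⇒ X⟩ₖ ⇒ B` (with `X` only positive in `Aⱼₖ` and `B`) and
`∀X. ⟨∀Y⃗ⱼ. X ⇒ Aⱼ⟩ⱼ ⇒ B` (with `X` only positive in `Aⱼ` and only negative in `B`). -/
inductive EpsEq (S : Ty → Prop) : List Ty → Tm → Tm → Ty → Prop
  | refl {Γ : List Ty} {t : Tm} {A : Ty} :
      HasType S (fun _ => True) Γ t A → EpsEq S Γ t t A
  | symm {Γ : List Ty} {t u : Tm} {A : Ty} : EpsEq S Γ t u A → EpsEq S Γ u t A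
  | trans {Γ : List Ty} {t u w : Tm} {A : Ty} :
      EpsEq S Γ t u A → EpsEq S Γ u w A → EpsEq S Γ t w A
  | lam {Γ : List Ty} {A B : Ty} {t u : Tm} :
      S (.arrow A B) → EpsEq S (A :: Γ) t u B → EpsEq S Γ (.lam A t) (.lam A u) (.arrow A B)
  | app {Γ : List Ty} {A B : Ty} {t t' u u' : Tm} :
      S B → EpsEq S Γ t t' (.arrow A B) → EpsEq S Γ u u' A →
      EpsEq S Γ (.app t u) (.app t' u') B
  | tlam {Γ : List Ty} {A : Ty} {t u : Tm} :
      S (.all A) → EpsEq S (Γ.map Ty.lift) t u A → EpsEq S Γ (.tlam t) (.tlam u) (.all A)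
  | tapp {Γ : List Ty} {A B : Ty} {t u : Tm} :
      S B → S (A.inst B) → EpsEq S Γ t u (.all A) →
      EpsEq S Γ (.tapp t B) (.tapp u B) (A.inst B)
  | beta {Γ : List Ty} {A B : Ty} {t u : Tm} :
      S (.arrow A B) → HasType S (fun _ => True) (A :: Γ) t B →
      HasType S (fun _ => True) Γ u A →
      EpsEq S Γ (.app (.lam A t) u) (t.inst u) B
  | tbeta {Γ : List Ty} {A B : Ty} {t : Tm} :
      S (.all A) → S B → S (A.inst B) → HasType S (fun _ => True) (Γ.map Ty.lift) t A →
      EpsEq S Γ (.tapp (.tlam t) B) (t.tinst B) (A.inst B)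
  | eta {Γ : List Ty} {A B : Ty} {t : Tm} :
      HasType S (fun _ => True) Γ t (.arrow A B) →
      EpsEq S Γ t (.lam A (.app (t.ren Nat.succ) (.var 0))) (.arrow A B)
  | teta {Γ : List Ty} {A : Ty} {t : Tm} :
      HasType S (fun _ => True) Γ t (.all A) →
      EpsEq S Γ t (.tlam (.tapp (t.tren Nat.succ) (.var 0))) (.all A)
  | eps_pos {Γ : List Ty} {E F B : Ty} {t v : Tm} {D : List AlgArg} :
      S E → S F →
      B.Occ true 0 → (∀ d ∈ D, ∀ A ∈ d.dom, A.Occ true d.n) →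
      HasType S (fun _ => True) Γ t (.all (arrows (D.map AlgArg.ty) B)) →
      (∀ d ∈ D, HasType S (fun _ => True) Γ d.src (d.ty.inst E)) →
      (∀ d ∈ D, HasType S (fun _ => True) Γ d.tgt (d.ty.inst F)) →
      HasType S (fun _ => True) (E :: Γ) v F →
      -- `Γ, Y⃗, z⃗ : ⟨Aⱼ[E]⟩ⱼ ⊢ v[src Y⃗ z⃗] ≃ tgt Y⃗ ⟨Φ_{Aⱼ}(v)[zⱼ]⟩ⱼ : F`
      (∀ d ∈ D, EpsEq S
        ((d.dom.map (Ty.subst (Ty.oneAt d.n E))).reverse ++ Γ.map (Ty.ren (· + d.n)))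
        ((weakenBody d.n d.dom.length v).inst
          (apps (tappVars (weaken d.n d.dom.length d.src) d.n) (tmVars d.dom.length)))
        (apps (tappVars (weaken d.n d.dom.length d.tgt) d.n)
          (List.zipWith
            (fun A z => act A d.n (Ty.oneAt d.n E) (Ty.oneAt d.n F)
              (weakenBody d.n d.dom.length v) z)
            d.dom (tmVars d.dom.length)))
        (F.ren (· + d.n))) →
      EpsEq S Γ
        (act B 0 (Ty.one E) (Ty.one F) v (apps (.tapp t E) (D.map AlgArg.src)))
        (apps (.tapp t F) (D.map AlgArg.tgt))
        (B.inst F)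
  | eps_neg {Γ : List Ty} {E F B : Ty} {t v : Tm} {D : List CoalgArg} :
      S E → S F →
      B.Occ false 0 → (∀ d ∈ D, d.cod.Occ true d.n) →
      HasType S (fun _ => True) Γ t (.all (arrows (D.map CoalgArg.ty) B)) →
      (∀ d ∈ D, HasType S (fun _ => True) Γ d.src (d.ty.inst E)) →
      (∀ d ∈ D, HasType S (fun _ => True) Γ d.tgt (d.ty.inst F)) →
      HasType S (fun _ => True) (E :: Γ) v F →
      -- `Γ, Y⃗, x : E ⊢ Φ_{A}(v)[src Y⃗ x] ≃ tgt Y⃗ (v[x]) : A[F]`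
      (∀ d ∈ D, EpsEq S
        (E.ren (· + d.n) :: Γ.map (Ty.ren (· + d.n)))
        (act d.cod d.n (Ty.oneAt d.n E) (Ty.oneAt d.n F) (weakenBody d.n 1 v)
          (.app (tappVars (weaken d.n 1 d.src) d.n) (.var 0)))
        (.app (tappVars (weaken d.n 1 d.tgt) d.n) ((weakenBody d.n 1 v).inst (.var 0)))
        (d.cod.subst (Ty.oneAt d.n F))) →
      EpsEq S Γ
        (act B 0 (Ty.one F) (Ty.one E) v (apps (.tapp t F) (D.map CoalgArg.tgt)))
        (apps (.tapp t E) (D.map CoalgArg.src))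
        (B.inst E)

/-! ### The polynomial fragment and the atomic system -/

/-- The polynomial type `P[X] = ⟨⟨Aⱼₖ⟩ⱼ ⇒ X⟩ₖ ⇒ X` in which `X` (the variable `0`) does not occur
in the types `Aⱼₖ`. -/
def polynomial (K : List (List Ty)) : Ty :=
  arrows (K.map fun As => arrows (As.map Ty.lift) (.var 0)) (.var 0)

/-- The types of the polynomial fragment: each universal type that occurs in them is of the form
`∀X.P[X]` for a polynomial type `P[X]` as above. -/
inductive Ty.Poly : Ty → Prop
  | var (i : ℕ) : Ty.Poly (.var i)
  | arrow {A B : Ty} : Ty.Poly A → Ty.Poly B → Ty.Poly (.arrow A B)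
  | all {K : List (List Ty)} :
      (∀ As ∈ K, ∀ A ∈ As, Ty.Poly A) → Ty.Poly (.all (polynomial K))

/-- Typing in the polynomial fragment: all types are types of the fragment. -/
def PolyTyped (Γ : List Ty) (t : Tm) (A : Ty) : Prop :=
  HasType Ty.Poly (fun _ => True) Γ t A

/-- Typing in the atomic system: all types of System F are allowed, but a term may only be
instantiated at a type variable. -/
def AtTyped (Γ : List Ty) (t : Tm) (A : Ty) : Prop :=
  HasType (fun _ => True) (fun B => ∃ i, B = .var i) Γ t A

end SystemF

/-! The only terms to be removed are instantiations `t B` at a compound type, where `t : ∀X.P[X]`.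
After `η`-expansion over the arguments of `P[B]`, it suffices to treat a saturated term `t B e₁ … eₖ
: B`, and this is done by induction on `B` (`exists_atomic_apps`). At a type variable there is
nothing to do. For `B = C ⇒ D` the term is `η`-equal to `λy. (t B e⃗) y`, and the elimination `v[x]
= x y` maps `B` to `D`; for `B = ∀Y.D` the elimination is `v[x] = x Y`. The `ε`-rule moves `v`
inside: `v[t B e⃗] ≃ t D f⃗` with `fₖ = λz⃗. v[eₖ z⃗]` (`exists_transport`), and the induction
hypothesis applies at `D`.

The premise of the `ε`-rule asks for `v[eₖ z⃗] ≃ fₖ ⟨Φ_A(v)[z]⟩`. Since `X` does not occur in the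
argument types of a polynomial type, `Φ_A(v)[z]` is only an `η`-expansion of `z` (`act_eta`), so the
premise reduces to `β` and `η`. Only rule (a) is needed, with no quantifiers `Y⃗ₖ` and with `X`
itself as conclusion.

No step introduces types outside the fragment. The induction therefore carries typings that are both
polynomial and atomic (`AtPolyTyped`), and the equation stays in the theory of the fragment. -/

namespace SystemF

/-! ### Renaming and substitution -/

theorem upr_id : upr id = id := by
  funext i; cases i <;> rfl

theorem upr_comp (ξ ζ : ℕ → ℕ) : upr ξ ∘ upr ζ = upr (ξ ∘ ζ) := by
  funext i; cases i <;> rfl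

theorem Ty.ren_id (A : Ty) : A.ren id = A := by
  induction A with
  | var i => rfl
  | arrow A B hA hB => simp only [Ty.ren, hA, hB]
  | all A hA => simp only [Ty.ren, upr_id, hA]

theorem Ty.ren_ren (A : Ty) : ∀ ξ ζ : ℕ → ℕ, (A.ren ζ).ren ξ = A.ren (ξ ∘ ζ) := by
  induction A with
  | var i => intros; rfl
  | arrow A B hA hB => intros; simp only [Ty.ren, hA, hB]
  | all A hA => intros; simp only [Ty.ren, hA, upr_comp]

theorem Ty.lift_ren (A : Ty) (ξ : ℕ → ℕ) : A.lift.ren (upr ξ) = (A.ren ξ).lift := by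
  simp only [Ty.lift, Ty.ren_ren]; rfl

theorem Ty.up_comp_upr (σ : ℕ → Ty) (ξ : ℕ → ℕ) : Ty.up σ ∘ upr ξ = Ty.up (σ ∘ ξ) := by
  funext i; cases i <;> rfl

theorem Ty.subst_ren (A : Ty) :
    ∀ (σ : ℕ → Ty) (ξ : ℕ → ℕ), (A.ren ξ).subst σ = A.subst (σ ∘ ξ) := by
  induction A with
  | var i => intros; rfl
  | arrow A B hA hB => intros; simp only [Ty.ren, Ty.subst, hA, hB]
  | all A hA => intros; simp only [Ty.ren, Ty.subst, hA, Ty.up_comp_upr]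

theorem Ty.ren_subst (A : Ty) :
    ∀ (σ : ℕ → Ty) (ξ : ℕ → ℕ), (A.subst σ).ren ξ = A.subst fun i => (σ i).ren ξ := by
  induction A with
  | var i => intros; rfl
  | arrow A B hA hB => intros; simp only [Ty.ren, Ty.subst, hA, hB]
  | all A hA =>
    intro σ ξ
    simp only [Ty.ren, Ty.subst, hA]
    congr 2
    funext i
    cases i with
    | zero => rfl
    | succ i => exact Ty.lift_ren _ _

theorem Ty.up_var : Ty.up Ty.var = Ty.var := by
  funext i; cases i <;> rfl

theorem Ty.subst_var (A : Ty) : A.subst Ty.var = A := by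
  induction A with
  | var i => rfl
  | arrow A B hA hB => simp only [Ty.subst, hA, hB]
  | all A hA => simp only [Ty.subst, Ty.up_var, hA]

theorem Ty.lift_subst_one (A B : Ty) : A.lift.subst (Ty.one B) = A :=
  (Ty.subst_ren _ _ _).trans (Ty.subst_var A)

theorem Ty.inst_ren (A B : Ty) (ξ : ℕ → ℕ) :
    (A.inst B).ren ξ = (A.ren (upr ξ)).inst (B.ren ξ) := by
  simp only [Ty.inst, Ty.ren_subst, Ty.subst_ren]
  congr 1
  funext i
  cases i <;> rfl

/-- This is what types `s Y` below a new binder `ΛY`: the weakened body, instantiated at the fresh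
variable, is the original body. -/
theorem Ty.ren_inst_var_zero (A : Ty) : (A.ren (upr Nat.succ)).inst (.var 0) = A := by
  rw [Ty.inst, Ty.subst_ren]
  convert Ty.subst_var A using 2
  funext i
  cases i <;> rfl

theorem Tm.tren_id (t : Tm) : t.tren id = t := by
  induction t with
  | var i => rfl
  | lam A t ht => simp only [Tm.tren, ht, Ty.ren_id]
  | app t u ht hu => simp only [Tm.tren, ht, hu]
  | tlam t ht => simp only [Tm.tren, upr_id, ht]
  | tapp t B ht => simp only [Tm.tren, ht, Ty.ren_id]

theorem Tm.ren_id (t : Tm) : t.ren id = t := by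
  induction t with
  | var i => rfl
  | lam A t ht => simp only [Tm.ren, upr_id, ht]
  | app t u ht hu => simp only [Tm.ren, ht, hu]
  | tlam t ht => simp only [Tm.ren, ht]
  | tapp t B ht => simp only [Tm.ren, ht]

theorem Tm.ren_ren (t : Tm) : ∀ ξ ζ : ℕ → ℕ, (t.ren ζ).ren ξ = t.ren (ξ ∘ ζ) := by
  induction t with
  | var i => intros; rfl
  | lam A t ht => intros; simp only [Tm.ren, ht, upr_comp]
  | app t u ht hu => intros; simp only [Tm.ren, ht, hu]
  | tlam t ht => intros; simp only [Tm.ren, ht]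
  | tapp t B ht => intros; simp only [Tm.ren, ht]

theorem Tm.up_var_comp (ξ : ℕ → ℕ) : Tm.up (fun i => .var (ξ i)) = fun i => .var (upr ξ i) := by
  funext i; cases i <;> rfl

theorem Tm.up_comp_upr (τ : ℕ → Tm) (ξ : ℕ → ℕ) : Tm.up τ ∘ upr ξ = Tm.up (τ ∘ ξ) := by
  funext i; cases i <;> rfl

theorem Tm.subst_ren (t : Tm) :
    ∀ (τ : ℕ → Tm) (ξ : ℕ → ℕ), (t.ren ξ).subst τ = t.subst (τ ∘ ξ) := by
  induction t with
  | var i => intros; rfl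
  | lam A t ht => intros; simp only [Tm.ren, Tm.subst, ht, Tm.up_comp_upr]
  | app t u ht hu => intros; simp only [Tm.ren, Tm.subst, ht, hu]
  | tlam t ht => intros; simp only [Tm.ren, Tm.subst, ht]; rfl
  | tapp t B ht => intros; simp only [Tm.ren, Tm.subst, ht]

theorem Tm.subst_var_comp (t : Tm) :
    ∀ ξ : ℕ → ℕ, t.subst (fun i => .var (ξ i)) = t.ren ξ := by
  induction t with
  | var i => intros; rfl
  | lam A t ht => intros; simp only [Tm.ren, Tm.subst, Tm.up_var_comp, ht]
  | app t u ht hu => intros; simp only [Tm.ren, Tm.subst, ht, hu]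
  | tlam t ht => intros; simp only [Tm.ren, Tm.subst, Tm.tren, ht]
  | tapp t B ht => intros; simp only [Tm.ren, Tm.subst, ht]

/-- Instantiating the variable of an abstraction weakened by `m + 1` variables with the outermost
of these variables. -/
theorem Tm.ren_upr_inst_var (t : Tm) (m : ℕ) :
    (t.ren (upr (· + (m + 1)))).inst (.var m) = t.ren (· + m) := by
  rw [Tm.inst, Tm.subst_ren, ← Tm.subst_var_comp]
  congr 1
  funext i
  cases i with
  | zero => simp [Tm.one, upr]
  | succ i => simp [Tm.one, upr]; omega

theorem weaken_zero (m : ℕ) (t : Tm) : weaken 0 m t = t.ren (· + m) :=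
  congrArg (Tm.ren (· + m)) (Tm.tren_id t)

theorem weakenBody_zero (m : ℕ) (v : Tm) : weakenBody 0 m v = v.ren (upr (· + m)) :=
  congrArg (Tm.ren (upr (· + m))) (Tm.tren_id v)

/-! ### Lists of arguments -/

theorem arrows_cons (A : Ty) (As : List Ty) (B : Ty) :
    arrows (A :: As) B = .arrow A (arrows As B) := rfl

theorem apps_cons (t u : Tm) (us : List Tm) : apps t (u :: us) = apps (.app t u) us := rfl

theorem arrows_ren (As : List Ty) (B : Ty) (ξ : ℕ → ℕ) :
    (arrows As B).ren ξ = arrows (As.map (Ty.ren ξ)) (B.ren ξ) := by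
  induction As with
  | nil => rfl
  | cons A As ih => simp only [arrows_cons, List.map_cons, Ty.ren, ih]

theorem arrows_subst (As : List Ty) (B : Ty) (σ : ℕ → Ty) :
    (arrows As B).subst σ = arrows (As.map (Ty.subst σ)) (B.subst σ) := by
  induction As with
  | nil => rfl
  | cons A As ih => simp only [arrows_cons, List.map_cons, Ty.subst, ih]

theorem apps_ren (us : List Tm) (ξ : ℕ → ℕ) :
    ∀ t : Tm, (apps t us).ren ξ = apps (t.ren ξ) (us.map (Tm.ren ξ)) := by
  induction us with
  | nil => intro t; rfl
  | cons u us ih => intro t; simp only [apps_cons, List.map_cons, ih, Tm.ren]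

theorem apps_tren (us : List Tm) (ξ : ℕ → ℕ) :
    ∀ t : Tm, (apps t us).tren ξ = apps (t.tren ξ) (us.map (Tm.tren ξ)) := by
  induction us with
  | nil => intro t; rfl
  | cons u us ih => intro t; simp only [apps_cons, List.map_cons, ih, Tm.tren]

theorem map_lift_subst_one (As : List Ty) (B : Ty) :
    (As.map Ty.lift).map (Ty.subst (Ty.one B)) = As := by
  simp [Function.comp_def, Ty.lift_subst_one]

theorem arrows_lift_inst (As : List Ty) (B : Ty) :
    (arrows (As.map Ty.lift) (.var 0)).inst B = arrows As B := by
  rw [Ty.inst, arrows_subst, map_lift_subst_one]; rfl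

/-- The types `Aⱼₖ` are lifted, so instantiation only affects the heads `X`. -/
theorem polynomial_inst (K : List (List Ty)) (B : Ty) :
    (polynomial K).inst B = arrows (K.map fun As => arrows As B) B := by
  rw [polynomial, Ty.inst, arrows_subst, List.map_map]
  congr 1
  exact List.map_congr_left fun As _ => arrows_lift_inst As B

theorem polynomial_ren (K : List (List Ty)) (ξ : ℕ → ℕ) :
    (polynomial K).ren (upr ξ) = polynomial (K.map fun As => As.map (Ty.ren ξ)) := by
  simp [polynomial, arrows_ren, Function.comp_def, Ty.lift_ren, Ty.ren, upr]

theorem tmVars_succ (m : ℕ) : tmVars (m + 1) = .var m :: tmVars m := by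
  simp [tmVars, List.range_succ]

theorem tmVars_length (m : ℕ) : (tmVars m).length = m := by simp [tmVars]

/-! ### Types of the polynomial fragment -/

theorem Ty.Poly.ren {A : Ty} (hA : A.Poly) : ∀ ξ : ℕ → ℕ, (A.ren ξ).Poly := by
  induction hA with
  | var i => exact fun ξ => .var _
  | arrow _ _ hA hB => exact fun ξ => .arrow (hA ξ) (hB ξ)
  | all _ ih =>
    intro ξ
    rw [Ty.ren, polynomial_ren]
    refine .all fun As hAs A hA => ?_
    obtain ⟨Bs, hBs, rfl⟩ := List.mem_map.1 hAs
    obtain ⟨B, hB, rfl⟩ := List.mem_map.1 hA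
    exact ih Bs hBs B hB ξ

theorem Ty.Poly.lift {A : Ty} (hA : A.Poly) : A.lift.Poly := hA.ren _

/-- Renaming along the predecessor function undoes the lift, and the fragment is closed under all
renamings. -/
theorem Ty.Poly.of_lift {A : Ty} (hA : A.lift.Poly) : A.Poly := by
  have h := hA.ren Nat.pred
  rw [Ty.lift, Ty.ren_ren] at h
  rwa [show Nat.pred ∘ Nat.succ = id from rfl, Ty.ren_id] at h

theorem Ty.Poly.arrows {As : List Ty} {B : Ty} (hAs : ∀ A ∈ As, A.Poly) (hB : B.Poly) :
    (arrows As B).Poly := by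
  induction As with
  | nil => exact hB
  | cons A As ih =>
    rw [List.forall_mem_cons] at hAs
    exact .arrow hAs.1 (ih hAs.2)

theorem Ty.Poly.arrow_inv {A B : Ty} (h : (Ty.arrow A B).Poly) : A.Poly ∧ B.Poly := by
  cases h with
  | arrow hA hB => exact ⟨hA, hB⟩

theorem Ty.Poly.all_inv {A : Ty} (h : (Ty.all A).Poly) :
    ∃ K, A = polynomial K ∧ ∀ As ∈ K, ∀ A ∈ As, Ty.Poly A := by
  cases h with
  | all h => exact ⟨_, rfl, h⟩

/-- The inductive definition only speaks of the `Aⱼₖ`; the body is again in the fragment because it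
is built from their lifts and `X` by arrows. This permits induction through `∀`. -/
theorem Ty.Poly.all_body {A : Ty} (h : (Ty.all A).Poly) : A.Poly := by
  obtain ⟨K, rfl, hK⟩ := h.all_inv
  refine .arrows (fun C hC => ?_) (.var 0)
  obtain ⟨As, hAs, rfl⟩ := List.mem_map.1 hC
  refine .arrows (fun D hD => ?_) (.var 0)
  obtain ⟨A, hA, rfl⟩ := List.mem_map.1 hD
  exact (hK As hAs A hA).lift

/-! ### Typing -/

section Typing

variable {S I J : Ty → Prop}

theorem HasType.mono {S' : Ty → Prop} (hS : ∀ A, S A → S' A) (hI : ∀ A, I A → J A)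
    {Γ : List Ty} {t : Tm} {A : Ty} (h : HasType S I Γ t A) : HasType S' J Γ t A := by
  induction h with
  | var hΓ hi => exact .var (fun B hB => hS _ (hΓ B hB)) hi
  | lam hS' _ ih => exact .lam (hS _ hS') ih
  | app hB _ _ iht ihu => exact .app (hS _ hB) iht ihu
  | tlam hA _ ih => exact .tlam (hS _ hA) ih
  | tapp hB hI' hAB _ ih => exact .tapp (hS _ hB) (hI _ hI') (hS _ hAB) ih

theorem HasType.true {Γ : List Ty} {t : Tm} {A : Ty} (h : HasType S I Γ t A) :
    HasType S (fun _ => True) Γ t A :=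
  h.mono (fun _ => id) fun _ _ => trivial

theorem HasType.type_mem {Γ : List Ty} {t : Tm} {A : Ty} (h : HasType S I Γ t A) : S A := by
  cases h with
  | var hΓ hi => exact hΓ _ (List.mem_of_getElem? hi)
  | lam h _ => exact h
  | app h _ _ => exact h
  | tlam h _ => exact h
  | tapp _ _ h _ => exact h

/-- Membership of the context in the fragment is only recorded at variables; it descends from the
leaves, using `Ty.Poly.of_lift` at a type abstraction. -/
theorem HasType.poly_ctx {Γ : List Ty} {t : Tm} {A : Ty} (h : HasType Ty.Poly I Γ t A) :
    ∀ B ∈ Γ, B.Poly := by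
  induction h with
  | var hΓ _ => exact hΓ
  | lam _ _ ih => exact fun B hB => ih B (List.mem_cons_of_mem _ hB)
  | app _ _ _ ih _ => exact ih
  | tlam _ _ ih => exact fun B hB => Ty.Poly.of_lift (ih _ (List.mem_map_of_mem hB))
  | tapp _ _ _ _ ih => exact ih

theorem Ty.Poly.map_lift {Γ : List Ty} (hΓ : ∀ B ∈ Γ, B.Poly) : ∀ B ∈ Γ.map Ty.lift, B.Poly := by
  intro B hB
  obtain ⟨C, hC, rfl⟩ := List.mem_map.1 hB
  exact (hΓ C hC).lift

/-- The hypothesis on `I` covers both uses: arbitrary instantiation, and instantiation at type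
variables. -/
theorem HasType.tren (hI : ∀ A ξ, I A → I (A.ren ξ))
    {Γ : List Ty} {t : Tm} {A : Ty} (h : HasType Ty.Poly I Γ t A) :
    ∀ ξ : ℕ → ℕ, HasType Ty.Poly I (Γ.map (Ty.ren ξ)) (t.tren ξ) (A.ren ξ) := by
  induction h with
  | var hΓ hi =>
    intro ξ
    refine .var (fun B hB => ?_) (by rw [List.getElem?_map, hi]; rfl)
    obtain ⟨C, hC, rfl⟩ := List.mem_map.1 hB
    exact (hΓ C hC).ren ξ
  | lam hAB _ ih => exact fun ξ => .lam (hAB.ren ξ) (ih ξ)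
  | app hB _ _ iht ihu => exact fun ξ => .app (hB.ren ξ) (iht ξ) (ihu ξ)
  | @tlam Γ A t hA _ ih =>
    intro ξ
    refine .tlam (hA.ren ξ) ?_
    convert ih (upr ξ) using 1
    simp [Function.comp_def, Ty.lift_ren]
  | tapp hB hIB hAB _ ih =>
    intro ξ
    have h := hAB.ren ξ
    rw [Ty.inst_ren] at h ⊢
    exact .tapp (hB.ren ξ) (hI _ ξ hIB) h (ih ξ)

theorem HasType.ren {Γ : List Ty} {t : Tm} {A : Ty} (h : HasType Ty.Poly I Γ t A) :
    ∀ {Δ : List Ty} {ξ : ℕ → ℕ}, (∀ B ∈ Δ, B.Poly) →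
      (∀ i B, Γ[i]? = some B → Δ[ξ i]? = some B) → HasType Ty.Poly I Δ (t.ren ξ) A := by
  induction h with
  | var hΓ hi => exact fun hΔ hξ => .var hΔ (hξ _ _ hi)
  | @lam Γ A B t hAB ht ih =>
    intro Δ ξ hΔ hξ
    refine .lam hAB (ih (List.forall_mem_cons.2 ⟨hAB.arrow_inv.1, hΔ⟩) ?_)
    intro i C hi
    cases i with
    | zero => exact hi
    | succ i => exact hξ i C hi
  | app hB _ _ iht ihu => exact fun hΔ hξ => .app hB (iht hΔ hξ) (ihu hΔ hξ)
  | tlam hA _ ih =>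
    intro Δ ξ hΔ hξ
    refine .tlam hA (ih (Ty.Poly.map_lift hΔ) fun i B hi => ?_)
    rw [List.getElem?_map, Option.map_eq_some_iff] at hi ⊢
    obtain ⟨C, hC, rfl⟩ := hi
    exact ⟨C, hξ i C hC, rfl⟩
  | tapp hB hIB hAB _ ih => exact fun hΔ hξ => .tapp hB hIB hAB (ih hΔ hξ)

theorem HasType.ren_succ {Γ : List Ty} {t : Tm} {A C : Ty} (h : HasType Ty.Poly I Γ t A)
    (hC : C.Poly) : HasType Ty.Poly I (C :: Γ) (t.ren Nat.succ) A :=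
  h.ren (List.forall_mem_cons.2 ⟨hC, h.poly_ctx⟩) fun _ _ hi => hi

theorem forall_mem_reverse_append {As Γ : List Ty} (hAs : ∀ A ∈ As, A.Poly)
    (hΓ : ∀ B ∈ Γ, B.Poly) : ∀ B ∈ As.reverse ++ Γ, B.Poly := by
  intro B hB
  rcases List.mem_append.1 hB with hB | hB
  · exact hAs B (List.mem_reverse.1 hB)
  · exact hΓ B hB

theorem getElem?_reverse_append_add (As Γ : List Ty) (i : ℕ) :
    (As.reverse ++ Γ)[i + As.length]? = Γ[i]? := by
  rw [List.getElem?_append_right (by simp)]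
  simp

theorem HasType.ren_add {Γ As : List Ty} {t : Tm} {A : Ty} (h : HasType Ty.Poly I Γ t A)
    (hAs : ∀ A ∈ As, A.Poly) :
    HasType Ty.Poly I (As.reverse ++ Γ) (t.ren (· + As.length)) A :=
  h.ren (forall_mem_reverse_append hAs h.poly_ctx) fun i _ hi =>
    (getElem?_reverse_append_add As Γ i).trans hi

theorem HasType.subst (hI : ∀ A ξ, I A → I (A.ren ξ))
    {Γ : List Ty} {t : Tm} {A : Ty} (h : HasType Ty.Poly I Γ t A) :
    ∀ {Δ : List Ty} {τ : ℕ → Tm}, (∀ B ∈ Δ, B.Poly) →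
      (∀ i B, Γ[i]? = some B → HasType Ty.Poly I Δ (τ i) B) →
      HasType Ty.Poly I Δ (t.subst τ) A := by
  induction h with
  | var _ hi => exact fun _ hτ => hτ _ _ hi
  | @lam Γ A B t hAB ht ih =>
    intro Δ τ hΔ hτ
    have hAΔ := List.forall_mem_cons.2 ⟨hAB.arrow_inv.1, hΔ⟩
    refine .lam hAB (ih hAΔ fun i C hi => ?_)
    cases i with
    | zero => exact .var hAΔ hi
    | succ i => exact (hτ i C hi).ren_succ hAB.arrow_inv.1
  | app hB _ _ iht ihu => exact fun hΔ hτ => .app hB (iht hΔ hτ) (ihu hΔ hτ)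
  | tlam hA _ ih =>
    intro Δ τ hΔ hτ
    refine .tlam hA (ih (Ty.Poly.map_lift hΔ) fun i B hi => ?_)
    rw [List.getElem?_map, Option.map_eq_some_iff] at hi
    obtain ⟨C, hC, rfl⟩ := hi
    exact (hτ i C hC).tren hI Nat.succ
  | tapp hB hIB hAB _ ih => exact fun hΔ hτ => .tapp hB hIB hAB (ih hΔ hτ)

theorem HasType.inst (hI : ∀ A ξ, I A → I (A.ren ξ)) {Γ : List Ty} {t u : Tm} {A B : Ty}
    (ht : HasType Ty.Poly I (A :: Γ) t B) (hu : HasType Ty.Poly I Γ u A) :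
    HasType Ty.Poly I Γ (t.inst u) B := by
  refine ht.subst hI hu.poly_ctx fun i C hi => ?_
  cases i with
  | zero =>
    obtain rfl : A = C := by simpa using hi
    exact hu
  | succ i => exact .var hu.poly_ctx hi

theorem Ty.Poly.arrows_inv {As : List Ty} {B : Ty} (h : (SystemF.arrows As B).Poly) :
    (∀ A ∈ As, A.Poly) ∧ B.Poly := by
  induction As with
  | nil => exact ⟨by simp, h⟩
  | cons A As ih =>
    have h' := Ty.Poly.arrow_inv h
    exact ⟨List.forall_mem_cons.2 ⟨h'.1, (ih h'.2).1⟩, (ih h'.2).2⟩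

theorem HasType.apps {Γ As : List Ty} {us : List Tm} {B : Ty}
    (hus : List.Forall₂ (fun A u => HasType Ty.Poly I Γ u A) As us) :
    ∀ {t : Tm}, HasType Ty.Poly I Γ t (arrows As B) → HasType Ty.Poly I Γ (apps t us) B := by
  induction hus with
  | nil => exact id
  | cons hu _ ih => exact fun ht => ih (.app (Ty.Poly.arrow_inv ht.type_mem).2 ht hu)

/-- The last variables introduced have the types recorded in the context. -/
theorem HasType.tmVars {As Γ : List Ty} (hAs : ∀ A ∈ As, A.Poly) (hΓ : ∀ B ∈ Γ, B.Poly) :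
    List.Forall₂ (fun A u => HasType Ty.Poly I (As.reverse ++ Γ) u A) As
      (tmVars As.length) := by
  induction As generalizing Γ with
  | nil => exact .nil
  | cons A As ih =>
    rw [List.length_cons, tmVars_succ]
    have h := List.forall_mem_cons.1 hAs
    refine .cons (.var (forall_mem_reverse_append hAs hΓ) ?_) ?_
    · simp
    · simpa using ih h.2 (List.forall_mem_cons.2 ⟨h.1, hΓ⟩)

theorem HasType.tapp_polynomial {Γ : List Ty} {t : Tm} {K : List (List Ty)} {B : Ty}
    (ht : HasType Ty.Poly I Γ t (.all (polynomial K))) (hK : ∀ As ∈ K, ∀ A ∈ As, Ty.Poly A)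
    (hB : B.Poly) (hIB : I B) :
    HasType Ty.Poly I Γ (.tapp t B) (arrows (K.map fun As => arrows As B) B) := by
  rw [← polynomial_inst]
  refine .tapp hB hIB ?_ ht
  rw [polynomial_inst]
  refine .arrows (fun C hC => ?_) hB
  obtain ⟨As, hAs, rfl⟩ := List.mem_map.1 hC
  exact .arrows (hK As hAs) hB

end Typing

/-! ### The epsilon-theory of the polynomial fragment -/

section Epsilon

theorem EpsEq.apps {Γ As : List Ty} {us : List Tm} {B : Ty}
    (hus : List.Forall₂ (fun A u => HasType Ty.Poly (fun _ => True) Γ u A) As us) :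
    ∀ {t t' : Tm}, (arrows As B).Poly → EpsEq Ty.Poly Γ t t' (arrows As B) →
      EpsEq Ty.Poly Γ (apps t us) (apps t' us) B := by
  induction hus with
  | nil => exact fun _ => id
  | cons hu _ ih =>
    exact fun hB ht => ih hB.arrow_inv.2 (.app hB.arrow_inv.2 ht (.refl hu))

/-- If the variable `i` does not occur in `A`, then the functorial action of `A` is an
`η`-expansion. -/
theorem act_eta {A : Ty} : ∀ {Γ : List Ty} {i : ℕ} {P Q : ℕ → Ty} {v s : Tm},
    A.Occ true i → A.Occ false i → (∀ j, j ≠ i → P j = Q j) → (A.subst P).Poly →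
    A.subst P = A.subst Q →
    HasType Ty.Poly (fun _ => True) Γ s (A.subst P) →
    HasType Ty.Poly (fun _ => True) Γ (act A i P Q v s) (A.subst P) ∧
      EpsEq Ty.Poly Γ s (act A i P Q v s) (A.subst P) := by
  induction A with
  | var j =>
    intro Γ i P Q v s hpos hneg _ _ _ hs
    have hj : j ≠ i := fun h => by simpa using hneg h
    rw [act, if_neg hj]
    exact ⟨hs, .refl hs⟩
  | arrow C D hC hD =>
    intro Γ i P Q v s hpos hneg hPQ hA hAQ hs
    have hA' := hA.arrow_inv
    obtain ⟨hCQ, hDQ⟩ : C.subst P = C.subst Q ∧ D.subst P = D.subst Q := by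
      simpa [Ty.subst] using hAQ
    have hx : HasType Ty.Poly (fun _ => True) (C.subst P :: Γ) (.var 0) (C.subst P) :=
      .var (List.forall_mem_cons.2 ⟨hA'.1, hs.poly_ctx⟩) rfl
    have hs' := hs.ren_succ hA'.1
    -- The domain is contravariant, so the polarities and `P`, `Q` are exchanged. As `C` has the
    -- same instance under both, the fresh variable has the required type.
    have h1 := hC (v := v.ren (upr Nat.succ)) hneg.1 hpos.1 (fun j hj => (hPQ j hj).symm)
      (hCQ ▸ hA'.1) hCQ.symm (hCQ ▸ hx)
    rw [← hCQ] at h1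
    have h2 := hD (v := v.ren (upr Nat.succ)) hpos.2 hneg.2 hPQ hA'.2 hDQ (.app hA'.2 hs' h1.1)
    rw [act, ← hCQ]
    exact ⟨.lam hA h2.1, (EpsEq.eta hs).trans
      (.lam hA ((EpsEq.app hA'.2 (.refl hs') h1.2).trans h2.2))⟩
  | all C hC =>
    intro Γ i P Q v s hpos hneg hPQ hA hAQ hs
    have hA' := hA.all_body
    have hs' := hs.tren (fun _ _ _ => trivial) Nat.succ
    have hs'' : HasType Ty.Poly (fun _ => True) (Γ.map Ty.lift)
        (.tapp (s.tren Nat.succ) (.var 0)) (C.subst (Ty.up P)) := by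
      have h : ((C.subst (Ty.up P)).ren (upr Nat.succ)).inst (.var 0) = C.subst (Ty.up P) :=
        Ty.ren_inst_var_zero _
      rw [← h]
      exact .tapp (.var 0) trivial (h.symm ▸ hA') hs'
    have h := hC (v := v.tren Nat.succ) hpos hneg (P := Ty.up P) (Q := Ty.up Q)
      (fun j hj => by
        cases j with
        | zero => rfl
        | succ j => simp only [Ty.up, hPQ j (fun h => hj (h ▸ rfl))])
      hA' (by simpa [Ty.subst] using hAQ) hs''
    exact ⟨.tlam hA h.1, (EpsEq.teta hs).trans (.tlam hA h.2)⟩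

/-- A variable outside the range of `ξ` does not occur at all, so either polarity holds vacuously.
-/
theorem Ty.occ_ren {A : Ty} : ∀ {i : ℕ} {ξ : ℕ → ℕ} (pos : Bool), (∀ j, ξ j ≠ i) →
    (A.ren ξ).Occ pos i := by
  induction A with
  | var j => exact fun _ hξ h => absurd h (hξ j)
  | arrow A B hA hB => exact fun _ hξ => ⟨hA _ hξ, hB _ hξ⟩
  | all A hA =>
    intro i ξ pos hξ
    refine hA pos fun j => ?_
    cases j with
    | zero => simp [upr]
    | succ j => simpa [upr] using hξ j

theorem Ty.occ_lift (A : Ty) (pos : Bool) : A.lift.Occ pos 0 :=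
  Ty.occ_ren pos Nat.succ_ne_zero

theorem act_lift_eta {Γ : List Ty} {A E F : Ty} {v s : Tm}
    (hs : HasType Ty.Poly (fun _ => True) Γ s A) :
    EpsEq Ty.Poly Γ s (act A.lift 0 (Ty.one E) (Ty.one F) v s) A := by
  have h := act_eta (A := A.lift) (i := 0) (P := Ty.one E) (Q := Ty.one F) (v := v)
    (A.occ_lift true) (A.occ_lift false)
    (fun j hj => by cases j with
      | zero => exact absurd rfl hj
      | succ j => rfl)
    (by rw [Ty.lift_subst_one]; exact hs.type_mem)
    (by rw [Ty.lift_subst_one, Ty.lift_subst_one]) (by rwa [Ty.lift_subst_one])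
  rw [Ty.lift_subst_one] at h
  exact h.2

/-- This deletes the actions `Φ_A(v)` from the right-hand side of the `ε`-premise when `X` does not
occur in the argument types. -/
theorem apps_act_lift {Γ As : List Ty} {us : List Tm} {E F B : Ty} {v : Tm}
    (hus : List.Forall₂ (fun A u => HasType Ty.Poly (fun _ => True) Γ u A) As us) :
    ∀ {t t' : Tm}, (arrows As B).Poly → EpsEq Ty.Poly Γ t t' (arrows As B) →
      EpsEq Ty.Poly Γ (apps t us)
        (apps t' (List.zipWith (fun A z => act A 0 (Ty.one E) (Ty.one F) v z)
          (As.map Ty.lift) us)) B := by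
  induction hus with
  | nil => exact fun _ => id
  | cons hu _ ih =>
    exact fun hB ht => ih hB.arrow_inv.2 (.app hB.arrow_inv.2 ht (act_lift_eta hu))

end Epsilon

/-! ### Atomization -/

section Atomization

/-- Typing in the polynomial fragment with instantiation at type variables only. -/
abbrev AtPolyTyped (Γ : List Ty) (t : Tm) (A : Ty) : Prop :=
  HasType Ty.Poly (fun B => ∃ i, B = .var i) Γ t A

theorem isVar_ren (A : Ty) (ξ : ℕ → ℕ) (hA : ∃ i, A = .var i) : ∃ i, A.ren ξ = .var i := by
  obtain ⟨i, rfl⟩ := hA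
  exact ⟨ξ i, rfl⟩

/-- Iterated abstraction, with the iterated `β`-equation. -/
theorem exists_lams {As : List Ty} : ∀ {Γ : List Ty} {u : Tm} {B : Ty},
    AtPolyTyped (As.reverse ++ Γ) u B →
    ∃ f, AtPolyTyped Γ f (arrows As B) ∧
      EpsEq Ty.Poly (As.reverse ++ Γ) (apps (f.ren (· + As.length)) (tmVars As.length)) u B := by
  induction As with
  | nil =>
    intro Γ u B hu
    refine ⟨u, hu, ?_⟩
    change EpsEq Ty.Poly Γ (u.ren id) u B
    rw [Tm.ren_id]
    exact .refl hu.true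
  | cons A As ih =>
    intro Γ u B hu
    have hΓ := hu.poly_ctx
    rw [List.reverse_cons, List.append_assoc, List.singleton_append] at hu hΓ
    obtain ⟨f, hf, hfu⟩ := ih hu
    have hAs : ∀ C ∈ As, C.Poly := fun C hC => hΓ C (by simp [hC])
    have hA : A.Poly := hΓ A (by simp)
    have hf' : AtPolyTyped Γ (.lam A f) (arrows (A :: As) B) := .lam (.arrow hA hf.type_mem) hf
    refine ⟨_, hf', ?_⟩
    have hAAs : ∀ C ∈ A :: As, C.Poly := List.forall_mem_cons.2 ⟨hA, hAs⟩
    have hvars := HasType.tmVars (I := fun _ => True) hAAs hf'.poly_ctx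
    rw [List.length_cons, tmVars_succ] at hvars ⊢
    have hlam := hf'.true.ren_add hAAs
    rw [List.reverse_cons, List.append_assoc, List.singleton_append] at *
    cases hlam with
    | lam hAB hbody =>
      cases hvars with
      | cons hv hvars =>
        refine .trans ?_ hfu
        have hBs := hAB.arrow_inv.2
        refine EpsEq.apps (B := B) hvars hBs ?_
        have hbeta := EpsEq.beta hAB hbody hv
        -- The first argument is the outermost variable, of index `As.length`. Substituting it in
        -- the body weakened by one variable more gives exactly the weakening in the induction
        -- hypothesis.
        rw [List.length_cons, Tm.ren_upr_inst_var] at hbeta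
        exact hbeta

/-- Iterated `η`-expansion. -/
theorem exists_of_apps {As : List Ty} : ∀ {Γ : List Ty} {t : Tm} {B : Ty},
    HasType Ty.Poly (fun _ => True) Γ t (arrows As B) →
    (∃ u, AtPolyTyped (As.reverse ++ Γ) u B ∧
      EpsEq Ty.Poly (As.reverse ++ Γ) (apps (t.ren (· + As.length)) (tmVars As.length)) u B) →
    ∃ t', AtPolyTyped Γ t' (arrows As B) ∧ EpsEq Ty.Poly Γ t t' (arrows As B) := by
  induction As with
  | nil =>
    rintro Γ t B ht ⟨u, hu, htu⟩
    change EpsEq Ty.Poly Γ (t.ren id) u B at htu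
    rw [Tm.ren_id] at htu
    exact ⟨u, hu, htu⟩
  | cons A As ih =>
    rintro Γ t B ht ⟨u, hu, htu⟩
    have hA := (Ty.Poly.arrow_inv ht.type_mem).1
    rw [List.reverse_cons, List.append_assoc, List.singleton_append] at hu htu
    rw [List.length_cons, tmVars_succ, apps_cons] at htu
    have ht' : HasType Ty.Poly (fun _ => True) (A :: Γ) (.app (t.ren Nat.succ) (.var 0))
        (arrows As B) :=
      .app (Ty.Poly.arrow_inv ht.type_mem).2 (ht.ren_succ hA)
        (.var (List.forall_mem_cons.2 ⟨hA, ht.poly_ctx⟩) rfl)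
    -- Weakening `t` by one and then by `As.length` is the full weakening, and the variable `0` just
    -- applied becomes `As.length`.
    obtain ⟨t', hAt, htt'⟩ := ih ht' ⟨u, hu, by
      convert htu using 2
      simp only [Tm.ren, Tm.ren_ren]
      congr 2
      · funext i
        simp only [Function.comp_apply]
        omega
      · simp⟩
    exact ⟨.lam A t', .lam ht.type_mem hAt, (EpsEq.eta ht).trans (.lam ht.type_mem htt')⟩

/-- The `ε`-rule for polynomial types: the terms `g p` correspond to the arguments `p.2` along
`v`. -/
theorem exists_transport {Γ : List Ty} {E F : Ty} {t v : Tm} {L : List (List Ty × Tm)}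
    (hE : E.Poly) (hF : F.Poly) (hv : AtPolyTyped (E :: Γ) v F)
    (ht : AtPolyTyped Γ t (.all (polynomial (L.map Prod.fst))))
    (hL : ∀ p ∈ L, AtPolyTyped Γ p.2 (arrows p.1 E)) :
    ∃ g : List Ty × Tm → Tm, (∀ p ∈ L, AtPolyTyped Γ (g p) (arrows p.1 F)) ∧
      EpsEq Ty.Poly Γ (v.inst (apps (.tapp t E) (L.map Prod.snd))) (apps (.tapp t F) (L.map g))
        F := by
  have : Nonempty Tm := ⟨.var 0⟩
  -- The witness is `f = λz⃗. v[e z⃗]`, and the equation is its iterated `β`-reduction.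
  have key : ∀ p ∈ L, ∃ f, AtPolyTyped Γ f (arrows p.1 F) ∧
      EpsEq Ty.Poly (p.1.reverse ++ Γ) (apps (f.ren (· + p.1.length)) (tmVars p.1.length))
        ((v.ren (upr (· + p.1.length))).inst
          (apps (p.2.ren (· + p.1.length)) (tmVars p.1.length))) F := by
    intro p hp
    have hAs := (Ty.Poly.arrows_inv (hL p hp).type_mem).1
    have hctx := forall_mem_reverse_append hAs ht.poly_ctx
    refine exists_lams (HasType.inst isVar_ren (A := E) ?_
      (HasType.apps (HasType.tmVars hAs ht.poly_ctx) ((hL p hp).ren_add hAs)))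
    refine hv.ren (List.forall_mem_cons.2 ⟨hE, hctx⟩) fun i B hi => ?_
    cases i with
    | zero => exact hi
    | succ i => exact (getElem?_reverse_append_add p.1 Γ i).trans hi
  choose! g hg hgv using key
  refine ⟨g, hg, ?_⟩
  -- No quantifiers `Y⃗ₖ` occur in a polynomial type, hence the `0`.
  let D : List AlgArg := L.map fun p => ⟨0, p.1.map Ty.lift, p.2, g p⟩
  have hty : ∀ p : List Ty × Tm, ∀ u u' : Tm, ∀ G : Ty,
      (AlgArg.ty ⟨0, p.1.map Ty.lift, u, u'⟩).inst G = arrows p.1 G :=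
    fun p _ _ G => arrows_lift_inst p.1 G
  have h := EpsEq.eps_pos (S := Ty.Poly) (Γ := Γ) (E := E) (F := F) (B := .var 0) (t := t)
    (v := v) (D := D) hE hF (fun _ => rfl) ?_ ?_ ?_ ?_ hv.true ?_
  -- With conclusion type `X`, the outer action is `Φ_X(v) = v`.
  · simpa [D, act, Function.comp_def, Ty.inst, Ty.subst, Ty.one] using h
  · simp only [D, List.forall_mem_map]
    exact fun p _ A _ => A.occ_lift true
  · convert ht.true using 1
    simp [D, polynomial, Function.comp_def, AlgArg.ty, alls]
  · simp only [D, List.forall_mem_map, hty]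
    exact fun p hp => (hL p hp).true
  · simp only [D, List.forall_mem_map, hty]
    exact fun p hp => (hg p hp).true
  · simp only [D, List.forall_mem_map]
    intro p hp
    have hren : (Ty.ren (· + 0)) = id := funext Ty.ren_id
    have hone : ∀ G : Ty, Ty.oneAt 0 G = Ty.one G := fun _ => rfl
    have hAs := (Ty.Poly.arrows_inv (hL p hp).type_mem).1
    have hvars := HasType.tmVars (I := fun _ => True) hAs ht.poly_ctx
    have hgp := (hg p hp).true.ren_add hAs
    simp only [hone, map_lift_subst_one, hren, List.map_id, List.length_map, weaken_zero,
      weakenBody_zero, id]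
    -- `β` gives `v[e z⃗] ≃ f z⃗`, and then each `z` is `η`-expanded to `Φ_A(v)[z]`.
    exact (hgv p hp).symm.trans (apps_act_lift hvars hgp.type_mem (.refl hgp))

/-- Saturated applications of an instance of a polynomial type can be atomized. -/
theorem exists_atomic_apps {B : Ty} : ∀ {Γ : List Ty} {t : Tm} {L : List (List Ty × Tm)},
    B.Poly → AtPolyTyped Γ t (.all (polynomial (L.map Prod.fst))) →
    (∀ p ∈ L, AtPolyTyped Γ p.2 (arrows p.1 B)) →
    ∃ u, AtPolyTyped Γ u B ∧ EpsEq Ty.Poly Γ (apps (.tapp t B) (L.map Prod.snd)) u B := by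
  -- Kept general in `I`: the atomic typing is used when `B` is a variable, the unrestricted one to
  -- justify the `η`-expansions at compound `B`.
  have happs : ∀ {I : Ty → Prop} {B : Ty} {Γ : List Ty} {t : Tm} {L : List (List Ty × Tm)},
      B.Poly → I B → HasType Ty.Poly I Γ t (.all (polynomial (L.map Prod.fst))) →
      (∀ p ∈ L, HasType Ty.Poly I Γ p.2 (arrows p.1 B)) →
      HasType Ty.Poly I Γ (apps (.tapp t B) (L.map Prod.snd)) B := by
    intro I B Γ t L hB hIB ht hL
    refine HasType.apps (As := (L.map Prod.fst).map fun As => arrows As B) ?_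
      (ht.tapp_polynomial ?_ hB hIB)
    · rw [List.map_map, List.forall₂_map_left_iff, List.forall₂_map_right_iff,
        List.forall₂_same]
      exact hL
    · simp only [List.forall_mem_map]
      exact fun p hp => (Ty.Poly.arrows_inv (hL p hp).type_mem).1
  induction B with
  | var i =>
    intro Γ t L hB ht hL
    have h := happs hB ⟨i, rfl⟩ ht hL
    exact ⟨_, h, .refl h.true⟩
  | arrow C D _ ih =>
    intro Γ t L hB ht hL
    obtain ⟨hC, hD⟩ := hB.arrow_inv
    have hs := happs hB trivial ht.true fun p hp => (hL p hp).true
    let L' : List (List Ty × Tm) := L.map fun p => (p.1, p.2.ren Nat.succ)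
    have hfst : L'.map Prod.fst = L.map Prod.fst := by simp [L', Function.comp_def]
    have hctx : ∀ X ∈ Ty.arrow C D :: C :: Γ, X.Poly :=
      List.forall_mem_cons.2 ⟨hB, List.forall_mem_cons.2 ⟨hC, ht.poly_ctx⟩⟩
    -- Here `v[x] = x y`, where `y : C` is the variable of the `η`-expansion, of index `1` below
    -- `x`.
    obtain ⟨g, hg, heq⟩ := exists_transport (Γ := C :: Γ) (E := .arrow C D) (F := D)
      (v := .app (.var 0) (.var 1)) (t := t.ren Nat.succ) (L := L') hB hD
      (.app hD (.var hctx rfl) (.var hctx rfl)) (hfst ▸ ht.ren_succ hC)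
      (by
        simp only [L', List.forall_mem_map]
        exact fun p hp => (hL p hp).ren_succ hC)
    let L'' : List (List Ty × Tm) := L'.map fun p => (p.1, g p)
    obtain ⟨u, hu, hequ⟩ := ih (Γ := C :: Γ) (t := t.ren Nat.succ) (L := L'') hD
      (by
        convert ht.ren_succ hC using 3
        simp [L'', L', Function.comp_def])
      (by
        simp only [L'', List.forall_mem_map] at hg ⊢
        exact hg)
    refine ⟨.lam C u, .lam hB hu, (EpsEq.eta hs).trans (.lam hB ?_)⟩
    convert heq.trans ?_ using 1
    · simp [apps_ren, Tm.inst, Tm.subst, Tm.one, Tm.ren, L', Function.comp_def]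
    · simpa [L'', Function.comp_def] using hequ
  | all D ih =>
    intro Γ t L hB ht hL
    have hD := hB.all_body
    have hs := happs hB trivial ht.true fun p hp => (hL p hp).true
    let L' : List (List Ty × Tm) := L.map fun p => (p.1.map Ty.lift, p.2.tren Nat.succ)
    have hctx : ∀ X ∈ (Ty.all D).lift :: Γ.map Ty.lift, X.Poly :=
      List.forall_mem_cons.2 ⟨hB.lift, Ty.Poly.map_lift ht.poly_ctx⟩
    have ht' : AtPolyTyped (Γ.map Ty.lift) (t.tren Nat.succ)
        (.all (polynomial (L'.map Prod.fst))) := by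
      have hL' : L'.map Prod.fst = (L.map Prod.fst).map fun As => As.map (Ty.ren Nat.succ) := by
        simp only [L', List.map_map]
        rfl
      rw [hL', ← polynomial_ren]
      exact ht.tren isVar_ren Nat.succ
    -- Here `v[x] = x Y`, with `Y` the fresh type variable: its only instantiation is atomic. The
    -- source type is weakened by `Y`, whereas the target `D` is already a type over `Y`.
    obtain ⟨g, hg, heq⟩ := exists_transport (Γ := Γ.map Ty.lift) (E := (Ty.all D).lift) (F := D)
      (v := .tapp (.var 0) (.var 0)) (t := t.tren Nat.succ) (L := L') hB.lift hD
      (by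
        have h := D.ren_inst_var_zero
        have htapp : AtPolyTyped ((Ty.all D).lift :: Γ.map Ty.lift) (.tapp (.var 0) (.var 0))
            ((D.ren (upr Nat.succ)).inst (.var 0)) :=
          .tapp (.var 0) ⟨0, rfl⟩ (h.symm ▸ hD) (.var hctx rfl)
        rwa [h] at htapp)
      ht'
      (by
        simp only [L', List.forall_mem_map]
        intro p hp
        have h := (hL p hp).tren isVar_ren Nat.succ
        rwa [arrows_ren] at h)
    let L'' : List (List Ty × Tm) := L'.map fun p => (p.1, g p)
    obtain ⟨u, hu, hequ⟩ := ih (Γ := Γ.map Ty.lift) (t := t.tren Nat.succ) (L := L'') hD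
      (by
        convert ht' using 3
        simp [L'', Function.comp_def])
      (by
        simp only [L'', List.forall_mem_map] at hg ⊢
        exact hg)
    refine ⟨.tlam u, .tlam hB hu, (EpsEq.teta hs).trans (.tlam hB ?_)⟩
    convert heq.trans ?_ using 1
    · simp [apps_tren, Tm.inst, Tm.subst, Tm.one, Tm.tren, L', Function.comp_def, Ty.lift]
    · simpa [L'', Function.comp_def] using hequ

/-- `η`-expansion over the arguments of `P[B]` makes the instance saturated, with fresh variables as
arguments. -/
theorem exists_atomic_tapp {Γ : List Ty} {t : Tm} {K : List (List Ty)} {B : Ty}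
    (hK : ∀ As ∈ K, ∀ A ∈ As, A.Poly) (hB : B.Poly)
    (ht : AtPolyTyped Γ t (.all (polynomial K))) :
    ∃ u, AtPolyTyped Γ u ((polynomial K).inst B) ∧
      EpsEq Ty.Poly Γ (.tapp t B) u ((polynomial K).inst B) := by
  rw [polynomial_inst]
  have htB := ht.true.tapp_polynomial hK hB trivial
  have hTs := (Ty.Poly.arrows_inv htB.type_mem).1
  refine exists_of_apps htB ?_
  have hvars := HasType.tmVars (I := fun B => ∃ i, B = .var i) hTs ht.poly_ctx
  rw [List.length_map] at hvars
  have hl := (tmVars_length K.length).symm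
  have hfst : (K.zip (tmVars K.length)).map Prod.fst = K := List.map_fst_zip hl.le
  have hsnd : (K.zip (tmVars K.length)).map Prod.snd = tmVars K.length := List.map_snd_zip hl.ge
  obtain ⟨u, hu, h⟩ := exists_atomic_apps (L := K.zip (tmVars K.length)) hB
    (by rw [hfst]; exact ht.ren_add hTs)
    (by
      rw [List.forall₂_map_left_iff, List.forall₂_iff_zip] at hvars
      exact fun p hp => hvars.2 hp)
  rw [hsnd] at h
  exact ⟨u, hu, by rwa [List.length_map] at h ⊢⟩

theorem exists_atomic {Γ : List Ty} {t : Tm} {A : Ty} (ht : PolyTyped Γ t A) :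
    ∃ t', AtPolyTyped Γ t' A ∧ EpsEq Ty.Poly Γ t t' A := by
  induction ht with
  | var hΓ hi => exact ⟨_, .var hΓ hi, .refl (.var hΓ hi)⟩
  | lam hAB _ ih =>
    obtain ⟨t', ht', h⟩ := ih
    exact ⟨_, .lam hAB ht', .lam hAB h⟩
  | app hB _ _ iht ihu =>
    obtain ⟨t', ht', h⟩ := iht
    obtain ⟨u', hu', h'⟩ := ihu
    exact ⟨_, .app hB ht' hu', .app hB h h'⟩
  | tlam hA _ ih =>
    obtain ⟨t', ht', h⟩ := ih
    exact ⟨_, .tlam hA ht', .tlam hA h⟩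
  | tapp hB _ hAB _ ih =>
    obtain ⟨t', ht', h⟩ := ih
    -- The restriction of the fragment enters here: a universal type of an instantiated term is
    -- polynomial.
    obtain ⟨K, rfl, hK⟩ := ht'.type_mem.all_inv
    obtain ⟨u, hu, h'⟩ := exists_atomic_tapp hK hB ht'
    exact ⟨u, hu, (EpsEq.tapp hB hAB h).trans h'⟩

end Atomization

end SystemF

/-- Every typing judgement of the polynomial fragment has an epsilon-equivalent one in the atomic
system. The equation already holds in the epsilon-theory of the polynomial fragment itself, hence in
that of every larger fragment. -/
theorem mainTheorem9 (Γ : List SystemF.Ty) (t : SystemF.Tm) (A : SystemF.Ty)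
    (ht : SystemF.PolyTyped Γ t A) :
    ∃ t' : SystemF.Tm, SystemF.AtTyped Γ t' A ∧
      SystemF.EpsEq SystemF.Ty.Poly Γ t t' A := by
  obtain ⟨t', ht', h⟩ := SystemF.exists_atomic ht
  exact ⟨t', ht'.mono (fun _ _ => trivial) fun _ => id, h⟩
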